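/- Let $(\Omega,\mathcal F,P)$ be a probability space, let $S$ be a complete separable metric space with Borel $\sigma$-algebra $\mathcal S$, and let $\xi=\{\xi_{ij}: i,j\in\mathbb N\}$ be an infinite array of $S$-valued random variables on $\Omega$ with rows $\xi_i=(\xi_{ij})_{j\in\mathbb N}$. A sequence $(X_i)_{i\in\mathbb N}$ of random variables is exchangeable if $(X_{k_1},\dots,X_{k_m})$ and $(X_1,\dots,X_m)$ have the same distribution whenever $k_1,\dots,k_m\in\mathbb N$ are distinct. Suppose that $\xi$ is row exchangeable, that is, each row $\xi_i$ is an exchangeable sequence in $S$, and the sequence of rows $(\xi_i)_{i\in\mathbb N}$ is an exchangeable sequence in $S^\infty=S^{\mathbb N}$. For a measurable space $T$, let $M_1(T)$ be the set of probability measures on $T$ with the $\sigma$-algebra generated by the maps $\nu\mapsto\nu(B)$, $B$ measurable; a random probability measure on $T$ is a measurable map $\Omega\to M_1(T)$. For $\nu\in M_1(T)$, let $\nu^\infty\in M_1(T^\infty)$ be the infinite product measure. For a random variable $X$ with values in $T$, a random variable $Y$, and a random probability measure $\nu$ on $T$, write $X\mid Y\sim\nu$ if $P(X\in A\mid\sigma(Y))=\nu(A)$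 a.s. for every measurable $A\subseteq T$. Then there exist a random probability measure $\varpi$ on $M_1(S)$ and a sequence $\mu=\{\mu_i:i\in\mathbb N\}$ of random probability measures on $S$ such that $$\mu\mid\varpi\sim\varpi^\infty\qquad\text{and}\qquad \xi_i\mid\mu_i\sim\mu_i^\infty\quad\text{for all } i\in\mathbb N,$$ and they are a.s. unique: if $\varpi'$ and $\mu'=\{\mu_i'\}$ is another such pair, then almost surely $\varpi'=\varpi$ and $\mu_i'=\mu_i$ for all $i\in\mathbb N$. -/

import Mathlib

open MeasureTheory ProbabilityTheory

/-- A sequence `X = (X_i)` of `T`-valued random variables on `(Ω, P)` is exchangeable if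
`(X_{k_1}, …, X_{k_m})` and `(X_1, …, X_m)` have the same distribution whenever
`k_1, …, k_m` are distinct indices. -/
def Exchangeable {Ω T : Type*} [MeasurableSpace Ω] [MeasurableSpace T]
    (P : Measure Ω) (X : ℕ → Ω → T) : Prop :=
  ∀ (m : ℕ) (k : Fin m → ℕ), Function.Injective k →
    IdentDistrib (fun ω (j : Fin m) => X (k j) ω) (fun ω (j : Fin m) => X j ω) P P

/-- An array `ξ = (ξ_{ij})` is row exchangeable if each row is an exchangeable sequence in `S`
and the sequence of rows is an exchangeable sequence in `S^∞`. -/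
structure RowExchangeable {Ω S : Type*} [MeasurableSpace Ω] [MeasurableSpace S]
    (P : Measure Ω) (ξ : ℕ → ℕ → Ω → S) : Prop where
  row : ∀ i, Exchangeable P (ξ i)
  rows : Exchangeable P (fun (i : ℕ) (ω : Ω) (j : ℕ) => ξ i j ω)

/-- The infinite product `ν^∞` of a probability measure `ν` on `T`, a probability measure on
`T^∞`. -/
noncomputable def infProd {T : Type*} [MeasurableSpace T] (ν : ProbabilityMeasure T) :
    ProbabilityMeasure (ℕ → T) :=
  ⟨Measure.infinitePi (fun _ : ℕ => (ν : Measure T)), inferInstance⟩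

/-- `X ∣ Y ∼ ν`: the random probability measure `ν` is a regular conditional distribution of `X`
given `σ(Y)`, that is, `P(X ∈ A ∣ σ(Y)) = ν(A)` a.s. for every measurable set `A`. -/
structure CondLaw {Ω T U : Type*} [MeasurableSpace Ω] [MeasurableSpace T]
    [mU : MeasurableSpace U] (P : Measure Ω) (X : Ω → T) (Y : Ω → U)
    (ν : Ω → ProbabilityMeasure T) : Prop where
  measurable : Measurable ν
  condProb : ∀ A : Set T, MeasurableSet A →
    P⟦X ⁻¹' A | mU.comap Y⟧ =ᵐ[P] fun ω => (ν ω : Measure T).real A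

/-!
The existence part is de Finetti's theorem applied twice; uniqueness is the law of large numbers.

*De Finetti.* Let `Q` be a law on `ℕ → T`, with `T` standard Borel, which is invariant under
injective reindexing (`Exchangeable.injInvariant`). Let `ν(x)` be the conditional distribution of
`x 0` given `x 1, x 2, …` (`directing`). Both `ν(B)` and its shift are conditional probabilities of
`x 0 ∈ B`, given `x 1, x 2, …` and given `x 2, x 3, …`. They have the same second moment by
stationarity, and the second is a projection of the first, so they agree almost surely
(`InjInvariant.ae_directing_shift_apply`). Hence `ν` is almost surely a function of any tail of the
sequence, and the coordinates can be peeled off one by one, each with conditional law `ν`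
(`InjInvariant.lintegral_prod_indicator_mul`). This says that the sequence has law `ν^∞` given `ν`
(`InjInvariant.hasCondDistrib_directing`).

*Existence.* The rows share one law `Q`, so `μ i = directing Q (ξ i)` applies a single measurable
map to an exchangeable sequence of rows and is itself exchangeable. De Finetti's theorem applies to
it in turn, because `ProbabilityMeasure S` is standard Borel: it is a measurable retract of
`ℚ → ℝ` through rational distribution functions (`standardBorelSpace_probabilityMeasure`).

*Uniqueness.* If `X` has law `ν^∞` given `ν`, then `ν(B)` is almost surely the limiting frequency
of visits of `X` to `B`, which does not involve `ν` (`ae_eq_of_hasCondDistrib_infProd`). So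
`μ' = μ` almost surely, and then `ϖ'` and `ϖ` both direct the sequence `μ`.
-/

/-! ### Probability measures on a standard Borel space form a standard Borel space -/

open Filter Topology Set in
lemma isRatStieltjesPoint_cdf (m : Measure ℝ) [IsProbabilityMeasure m] :
    IsRatStieltjesPoint (id : (ℚ → ℝ) → ℚ → ℝ) (fun q : ℚ => cdf m q) where
  mono := fun a b hab => (cdf m).mono (by exact_mod_cast hab)
  tendsto_atTop_one := (tendsto_cdf_atTop m).comp (tendsto_ratCast_atTop_iff.2 tendsto_id)
  tendsto_atBot_zero := (tendsto_cdf_atBot m).comp (tendsto_ratCast_atBot_iff.2 tendsto_id)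
  iInf_rat_gt_eq t := by
    simp only [id]
    rw [← (cdf m).iInf_rat_gt_eq (t : ℝ)]
    refine Equiv.iInf_congr
      { toFun := fun r => ⟨r.1, by exact_mod_cast r.2⟩
        invFun := fun r => ⟨r.1, by exact_mod_cast r.2⟩
        left_inv := fun _ => rfl
        right_inv := fun _ => rfl } (fun _ => rfl)

/-- A probability measure on `ℝ` is recovered from the restriction of its distribution function
to `ℚ`. -/
lemma measure_stieltjesOfMeasurableRat_cdf (m : Measure ℝ) [IsProbabilityMeasure m] :
    (stieltjesOfMeasurableRat (id : (ℚ → ℝ) → ℚ → ℝ) measurable_id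
      (fun q : ℚ => cdf m q)).measure = m := by
  set F := stieltjesOfMeasurableRat (id : (ℚ → ℝ) → ℚ → ℝ) measurable_id (fun q : ℚ => cdf m q)
  have hF : F = cdf m := by
    ext x
    rw [← F.iInf_rat_gt_eq, ← (cdf m).iInf_rat_gt_eq]
    refine iInf_congr fun r => ?_
    rw [stieltjesOfMeasurableRat_eq, toRatCDF_of_isRatStieltjesPoint (isRatStieltjesPoint_cdf m)]
    rfl
  rw [hF, measure_cdf]

/-- A measurable retract of a standard Borel space is standard Borel: its image is the set where
the retraction is inverted, hence measurable. -/
lemma standardBorelSpace_of_leftInverse {X Y : Type*} [MeasurableSpace X] [MeasurableSpace Y]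
    [StandardBorelSpace Y] {f : X → Y} {g : Y → X} (hf : Measurable f) (hg : Measurable g)
    (h : Function.LeftInverse g f) : StandardBorelSpace X := by
  have hr : Set.range f = {y | f (g y) = y} := by
    ext y
    constructor
    · rintro ⟨x, rfl⟩
      simp [h x]
    · intro hy
      exact ⟨g y, hy⟩
  have hrm : MeasurableSet (Set.range f) := by
    rw [hr]
    exact measurableSet_eq_fun (hf.comp hg) measurable_id
  have := hrm.standardBorel
  let e := (MeasurableEmbedding.of_measurable_inverse hf hrm hg h).equivRange
  let := upgradeStandardBorel (Set.range f)
  let τ : TopologicalSpace X := .induced e inferInstance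
  refine ⟨τ, ⟨?_⟩, e.toEquiv.polishSpace_induced⟩
  exact e.measurableEmbedding.comap_eq.symm.trans <|
    (congrArg (MeasurableSpace.comap (⇑e)) (eq_borel_upgradeStandardBorel (Set.range f))).trans
      borel_comap.symm

lemma measurable_probabilityMeasure_iff {U T : Type*} [MeasurableSpace U] [MeasurableSpace T]
    {K : U → ProbabilityMeasure T} :
    Measurable K ↔ ∀ s, MeasurableSet s → Measurable fun u => (K u : Measure T) s := by
  rw [← Measure.measurable_measure]
  exact ⟨fun h => measurable_subtype_coe.comp h, fun h => h.subtype_mk⟩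

instance standardBorelSpace_probabilityMeasure {T : Type*} [MeasurableSpace T]
    [StandardBorelSpace T] [Nonempty T] : StandardBorelSpace (ProbabilityMeasure T) := by
  obtain ⟨e, he⟩ := exists_measurableEmbedding_real T
  obtain ⟨r, hr, hre⟩ := he.exists_measurable_extend measurable_id (fun _ => inferInstance)
  have hpm : ∀ ν : ProbabilityMeasure T, IsProbabilityMeasure ((ν : Measure T).map e) :=
    fun ν => Measure.isProbabilityMeasure_map he.measurable.aemeasurable
  let S := stieltjesOfMeasurableRat (id : (ℚ → ℝ) → ℚ → ℝ) measurable_id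
  have hpr : ∀ F, IsProbabilityMeasure ((S F).measure.map r) :=
    fun F => Measure.isProbabilityMeasure_map hr.aemeasurable
  refine standardBorelSpace_of_leftInverse
    (f := fun ν : ProbabilityMeasure T => fun q : ℚ => cdf ((ν : Measure T).map e) q)
    (g := fun F => ⟨(S F).measure.map r, hpr F⟩) ?_ ?_ ?_
  · refine measurable_pi_lambda _ fun q => ?_
    simp_rw [cdf_eq_real, Measure.real]
    refine Measurable.ennreal_toReal ?_
    exact (Measure.measurable_coe measurableSet_Iic).comp
      ((Measure.measurable_map e he.measurable).comp measurable_subtype_coe)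
  · exact ((Measure.measurable_map r hr).comp
      (measurable_measure_stieltjesOfMeasurableRat measurable_id)).subtype_mk
  · intro ν
    apply Subtype.ext
    change Measure.map r (S _).measure = _
    rw [measure_stieltjesOfMeasurableRat_cdf, Measure.map_map hr he.measurable, hre,
      Measure.map_id]
    rfl

/-! ### Conditional laws as disintegrations -/

section CondLaw

variable {Ω T U : Type*} [MeasurableSpace Ω] [MeasurableSpace T] [MeasurableSpace U]

/-- The Markov kernel given by a measurable family of probability measures. -/
def kernelOf (K : U → ProbabilityMeasure T) (hK : Measurable K) : Kernel U T :=
  ⟨fun u => (K u : Measure T), measurable_subtype_coe.comp hK⟩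

instance isMarkovKernel_kernelOf (K : U → ProbabilityMeasure T) (hK : Measurable K) :
    IsMarkovKernel (kernelOf K hK) :=
  ⟨fun u => (K u).2⟩

variable {P : Measure Ω} [IsProbabilityMeasure P] {X : Ω → T} {Y : Ω → U}
  {K : U → ProbabilityMeasure T}

lemma hasCondDistrib_kernelOf_iff (hX : Measurable X) (hY : Measurable Y) (hK : Measurable K) :
    HasCondDistrib X Y (kernelOf K hK) P ↔
      ∀ (C : Set U) (A : Set T), MeasurableSet C → MeasurableSet A →
        P (Y ⁻¹' C ∩ X ⁻¹' A) = ∫⁻ ω in Y ⁻¹' C, (K (Y ω) : Measure T) A ∂P := by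
  have hXY : Measurable fun ω => (Y ω, X ω) := hY.prodMk hX
  have := Measure.isProbabilityMeasure_map (μ := P) hXY.aemeasurable
  have key : ∀ (C : Set U) (A : Set T), MeasurableSet C → MeasurableSet A →
      (P.map Y ⊗ₘ kernelOf K hK) (C ×ˢ A) = ∫⁻ ω in Y ⁻¹' C, (K (Y ω) : Measure T) A ∂P := by
    intro C A hC hA
    rw [Measure.compProd_apply_prod hC hA, setLIntegral_map hC (Kernel.measurable_coe _ hA) hY]
    rfl
  have key' : ∀ (C : Set U) (A : Set T), MeasurableSet C → MeasurableSet A →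
      P.map (fun ω => (Y ω, X ω)) (C ×ˢ A) = P (Y ⁻¹' C ∩ X ⁻¹' A) := by
    intro C A hC hA
    rw [Measure.map_apply hXY (hC.prod hA), Set.mk_preimage_prod]
  constructor
  · intro h C A hC hA
    rw [← key C A hC hA, ← h.map_eq, key' C A hC hA]
  · intro h
    refine ⟨hXY.aemeasurable, Measure.ext_prod_iff.2 fun {C A} hC hA => ?_⟩
    rw [key C A hC hA, key' C A hC hA, h C A hC hA]

/-- When the random probability measure is a measurable function of `Y`, being a conditional law
given `σ(Y)` means disintegrating the joint law of `Y` and `X`. -/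
lemma condLaw_iff_hasCondDistrib (hX : Measurable X) (hY : Measurable Y) (hK : Measurable K) :
    CondLaw P X Y (fun ω => K (Y ω)) ↔ HasCondDistrib X Y (kernelOf K hK) P := by
  rw [hasCondDistrib_kernelOf_iff hX hY hK]
  have hKA : ∀ A, MeasurableSet A → Measurable fun u => (K u : Measure T) A :=
    fun A hA => measurable_probabilityMeasure_iff.1 hK A hA
  have hbd : ∀ A ω, ‖(K (Y ω) : Measure T).real A‖ ≤ 1 := by
    intro A ω
    rw [Real.norm_of_nonneg measureReal_nonneg]
    exact measureReal_le_one
  have hint : ∀ A, MeasurableSet A → Integrable (fun ω => (K (Y ω) : Measure T).real A) P :=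
    fun A hA => .of_bound ((hKA A hA).comp hY).ennreal_toReal.aestronglyMeasurable 1
      (.of_forall (hbd A))
  have hset : ∀ (C : Set U) (A : Set T), MeasurableSet A →
      ∫ ω in Y ⁻¹' C, (K (Y ω) : Measure T).real A ∂P
        = (∫⁻ ω in Y ⁻¹' C, (K (Y ω) : Measure T) A ∂P).toReal := by
    intro C A hA
    exact integral_toReal ((hKA A hA).comp hY).aemeasurable
      (.of_forall fun ω => measure_lt_top _ _)
  have hind : ∀ (C : Set U) (A : Set T), MeasurableSet A →
      ∫ ω in Y ⁻¹' C, (X ⁻¹' A).indicator (fun _ => (1 : ℝ)) ω ∂P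
        = (P (Y ⁻¹' C ∩ X ⁻¹' A)).toReal := by
    intro C A hA
    rw [integral_indicator (hX hA), setIntegral_const, smul_eq_mul, mul_one,
      measureReal_restrict_apply (hX hA), Set.inter_comm]
    rfl
  have hintI : ∀ A, MeasurableSet A →
      Integrable ((X ⁻¹' A).indicator (fun _ => (1 : ℝ))) P :=
    fun A hA => (integrable_const _).indicator (hX hA)
  have hfin : ∀ (C : Set U) (A : Set T),
      ∫⁻ ω in Y ⁻¹' C, (K (Y ω) : Measure T) A ∂P ≠ ⊤ := by
    intro C A
    refine ne_top_of_le_ne_top (measure_ne_top P (Y ⁻¹' C)) ?_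
    calc ∫⁻ ω in Y ⁻¹' C, (K (Y ω) : Measure T) A ∂P ≤ ∫⁻ ω in Y ⁻¹' C, 1 ∂P :=
          lintegral_mono fun ω => prob_le_one
      _ = P (Y ⁻¹' C) := by simp
  constructor
  · intro h C A hC hA
    rw [← ENNReal.toReal_eq_toReal_iff' (measure_ne_top _ _) (hfin C A), ← hset C A hA,
      ← hind C A hA, ← setIntegral_condExp hY.comap_le (hintI A hA) ⟨C, hC, rfl⟩]
    exact setIntegral_congr_ae (hY hC) ((h.condProb A hA).mono fun ω hω _ => hω)
  · intro h
    refine ⟨hK.comp hY, fun A hA => ?_⟩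
    refine (ae_eq_condExp_of_forall_setIntegral_eq hY.comap_le (hintI A hA)
      (fun s _ _ => (hint A hA).integrableOn) ?_ ?_).symm
    · rintro _ ⟨C, hC, rfl⟩ _
      rw [hset C A hA, hind C A hA, h C A hC hA]
    · exact ((hKA A hA).ennreal_toReal.comp (comap_measurable Y)).aestronglyMeasurable

end CondLaw

/-! ### Infinite product measures -/

section InfProd

variable {T : Type*} [MeasurableSpace T]

lemma measurable_infProd : Measurable (infProd (T := T)) := by
  refine Measurable.subtype_mk ?_
  refine Measurable.measure_of_isPiSystem_of_isProbabilityMeasure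
    generateFrom_squareCylinders.symm
    (isPiSystem_squareCylinders (fun _ => MeasurableSpace.isPiSystem_measurableSet)
      (fun _ => MeasurableSet.univ)) ?_
  rintro _ ⟨s, t, ht, rfl⟩
  have ht' : ∀ i, MeasurableSet (t i) := fun i => ht i (Set.mem_univ i)
  simp_rw [Measure.infinitePi_pi _ (fun i _ => ht' i)]
  exact Finset.measurable_prod _ fun i _ => (Measure.measurable_coe (ht' i)).comp
    measurable_subtype_coe

end InfProd

/-! ### De Finetti's theorem on sequence space -/

/-- If the σ-algebra is countably generated, random probability measures that almost surely agree
on each measurable set are almost surely equal. -/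
lemma ae_eq_of_forall_ae_measure_eq {α T : Type*} [MeasurableSpace α] [MeasurableSpace T]
    [MeasurableSpace.CountablyGenerated T] {P : Measure α} {μ ν : α → ProbabilityMeasure T}
    (h : ∀ s, MeasurableSet s → ∀ᵐ a ∂P, (μ a : Measure T) s = (ν a : Measure T) s) :
    ∀ᵐ a ∂P, μ a = ν a := by
  let 𝒜 := generateSetAlgebra (MeasurableSpace.countableGeneratingSet T)
  have hgen : ‹MeasurableSpace T› = MeasurableSpace.generateFrom 𝒜 := by
    rw [generateFrom_generateSetAlgebra_eq, MeasurableSpace.generateFrom_countableGeneratingSet]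
  have hmeas : ∀ s ∈ 𝒜, MeasurableSet s := by
    intro s hs
    rw [hgen]
    exact MeasurableSpace.measurableSet_generateFrom hs
  have hcount : 𝒜.Countable :=
    countable_generateSetAlgebra MeasurableSpace.countable_countableGeneratingSet
  have hall : ∀ᵐ a ∂P, ∀ s ∈ 𝒜, (μ a : Measure T) s = (ν a : Measure T) s :=
    (ae_ball_iff hcount).2 fun s hs => h s (hmeas s hs)
  filter_upwards [hall] with a ha
  have h_eq : (μ a : Measure T) = (ν a : Measure T) :=
    ext_of_generate_finite 𝒜 hgen
      isSetAlgebra_generateSetAlgebra.isSetRing.isSetSemiring.isPiSystem ha (by simp)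
  exact Subtype.ext h_eq

section DeFinetti

variable {T : Type*} [MeasurableSpace T]

/-- The left shift on sequences. -/
def shift (x : ℕ → T) : ℕ → T := fun i => x (i + 1)

@[fun_prop]
lemma measurable_shift : Measurable (shift (T := T)) :=
  measurable_pi_lambda _ fun i => measurable_pi_apply (i + 1)

lemma measurable_shift_iterate (m : ℕ) : Measurable ((shift (T := T))^[m]) :=
  measurable_shift.iterate m

/-- A law on sequences is `InjInvariant` if every injective reindexing of the coordinates, a
permutation or not, preserves it. In particular it is shift invariant. -/
def InjInvariant (Q : Measure (ℕ → T)) : Prop :=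
  ∀ k : ℕ → ℕ, Function.Injective k → Q.map (fun x i => x (k i)) = Q

lemma InjInvariant.measurePreserving_shift {Q : Measure (ℕ → T)} (hQ : InjInvariant Q) :
    MeasurePreserving shift Q Q :=
  ⟨measurable_shift, hQ (· + 1) (add_left_injective 1)⟩

variable [StandardBorelSpace T] [Nonempty T]

/-- The directing random measure of a law on sequences: the conditional distribution of the
first coordinate given all the later ones, evaluated at a sequence. -/
noncomputable def directing (Q : Measure (ℕ → T)) [IsFiniteMeasure Q] (x : ℕ → T) :
    ProbabilityMeasure T :=
  ⟨condDistrib (fun y : ℕ → T => y 0) shift Q (shift x), inferInstance⟩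

variable (Q : Measure (ℕ → T)) [IsProbabilityMeasure Q]

lemma measurable_directing : Measurable (directing Q) :=
  ((Kernel.measurable _).comp measurable_shift).subtype_mk

lemma measurable_directing_apply {B : Set T} (hB : MeasurableSet B) :
    Measurable fun x => (directing Q x : Measure T) B :=
  measurable_probabilityMeasure_iff.1 (measurable_directing Q) B hB

/-- The defining property of `directing`, integrated: conditionally on the later coordinates the
first one has law `directing Q x`. -/
lemma lintegral_indicator_mul_shift {B : Set T} (hB : MeasurableSet B)
    {F : (ℕ → T) → ENNReal} (hF : Measurable F) :
    ∫⁻ x, B.indicator 1 (x 0) * F (shift x) ∂Q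
      = ∫⁻ x, (directing Q x : Measure T) B * F (shift x) ∂Q := by
  have h0 : Measurable fun y : ℕ → T => y 0 := measurable_pi_apply 0
  have hI : Measurable (B.indicator (1 : T → ENNReal)) := measurable_one.indicator hB
  have hG : Measurable fun p : (ℕ → T) × T => B.indicator (1 : T → ENNReal) p.2 * F p.1 :=
    (hI.comp measurable_snd).mul (hF.comp measurable_fst)
  have hjoint := compProd_map_condDistrib (μ := Q) (X := shift)
    (mβ := MeasurableSpace.pi) h0.aemeasurable
  calc ∫⁻ x, B.indicator 1 (x 0) * F (shift x) ∂Q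
      = ∫⁻ p, B.indicator 1 p.2 * F p.1 ∂(Q.map fun x => (shift x, x 0)) :=
        (lintegral_map hG (measurable_shift.prodMk h0)).symm
    _ = ∫⁻ y, ∫⁻ t, B.indicator 1 t * F y ∂(condDistrib (fun y : ℕ → T => y 0) shift Q y)
          ∂(Q.map shift) := by
        rw [← hjoint, Measure.lintegral_compProd hG]
    _ = ∫⁻ y, condDistrib (fun y : ℕ → T => y 0) shift Q y B * F y ∂(Q.map shift) := by
        refine lintegral_congr fun y => ?_
        rw [lintegral_mul_const _ hI, lintegral_indicator_one hB]
    _ = _ := lintegral_map ((Kernel.measurable_coe _ hB).mul hF) measurable_shift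

variable {Q}

/-- The directing measure is almost surely shift invariant. Writing `U = ν(B)` and `V` for its
shift, invariance of the law makes `E[UV] = E[U²] = E[V²]`, whence `E[(U - V)²] = 0`. -/
lemma InjInvariant.ae_directing_shift_apply (hQ : InjInvariant Q) {B : Set T}
    (hB : MeasurableSet B) :
    ∀ᵐ x ∂Q, (directing Q (shift x) : Measure T) B = (directing Q x : Measure T) B := by
  let g : (ℕ → T) → ENNReal := fun x => (directing Q x : Measure T) B
  have hg : Measurable g := measurable_directing_apply Q hB
  have hk : Measurable fun (x : ℕ → T) (i : ℕ) => x (if i = 0 then 0 else i + 1) :=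
    measurable_pi_lambda _ fun i => measurable_pi_apply _
  have hkinj : Function.Injective fun i : ℕ => if i = 0 then 0 else i + 1 := by
    intro i j hij
    dsimp only at hij
    split_ifs at hij <;> omega
  have hI : Measurable fun x : ℕ → T => B.indicator (1 : T → ENNReal) (x 0) :=
    (measurable_one.indicator hB).comp (measurable_pi_apply 0)
  let h : (ℕ → T) → ENNReal := fun y => condDistrib (fun y : ℕ → T => y 0) shift Q y B
  have hh : Measurable h := Kernel.measurable_coe _ hB
  -- The sequence without its second coordinate has the law of the whole sequence.
  have huv : ∫⁻ x, g x * g (shift x) ∂Q = ∫⁻ x, g x * g x ∂Q := by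
    calc ∫⁻ x, g x * g (shift x) ∂Q
        = ∫⁻ x, B.indicator 1 (x 0) * g (shift x) ∂Q :=
          (lintegral_indicator_mul_shift Q hB hg).symm
      _ = ∫⁻ x, B.indicator 1 (x 0) * h (shift x)
            ∂(Q.map fun x i => x (if i = 0 then 0 else i + 1)) := by
          refine (lintegral_map
            (f := fun x : ℕ → T => B.indicator (1 : T → ENNReal) (x 0) * h (shift x))
            (hI.mul (hh.comp measurable_shift)) hk).symm
      _ = ∫⁻ x, B.indicator 1 (x 0) * h (shift x) ∂Q := by rw [hQ _ hkinj]
      _ = ∫⁻ x, g x * g x ∂Q := lintegral_indicator_mul_shift Q hB hh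
  have hvv : ∫⁻ x, g (shift x) * g (shift x) ∂Q = ∫⁻ x, g x * g x ∂Q :=
    hQ.measurePreserving_shift.lintegral_comp (hg.mul hg)
  let u : (ℕ → T) → ℝ := fun x => (g x).toReal
  have hu : Measurable u := hg.ennreal_toReal
  have hub : ∀ x, ‖u x‖ ≤ 1 := fun x => by
    rw [Real.norm_of_nonneg ENNReal.toReal_nonneg]
    exact measureReal_le_one
  have hreal : ∀ a b : (ℕ → T) → (ℕ → T), Measurable a → Measurable b →
      Integrable (fun x => u (a x) * u (b x)) Q ∧
      ∫ x, u (a x) * u (b x) ∂Q = (∫⁻ x, g (a x) * g (b x) ∂Q).toReal := by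
    intro a b ha hb
    constructor
    · refine .of_bound ((hu.comp ha).mul (hu.comp hb)).aestronglyMeasurable 1 (.of_forall ?_)
      intro x
      rw [norm_mul]
      exact mul_le_one₀ (hub _) (norm_nonneg _) (hub _)
    · simp_rw [u, ← ENNReal.toReal_mul]
      exact integral_toReal ((hg.comp ha).mul (hg.comp hb)).aemeasurable
        (.of_forall fun x => ENNReal.mul_lt_top (measure_lt_top _ _) (measure_lt_top _ _))
  obtain ⟨i1, e1⟩ := hreal id id measurable_id measurable_id
  obtain ⟨i2, e2⟩ := hreal id shift measurable_id measurable_shift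
  obtain ⟨i3, e3⟩ := hreal shift shift measurable_shift measurable_shift
  simp only [id] at i1 e1 i2 e2
  have hsq : ∀ x, (u (shift x) - u x) ^ 2
      = u (shift x) * u (shift x) + u x * u x - 2 * (u x * u (shift x)) := fun x => by ring
  have hzero : ∫ x, (u (shift x) - u x) ^ 2 ∂Q = 0 := by
    simp_rw [hsq]
    have hsub := integral_sub (i3.add i1) (i2.const_mul 2)
    simp only [Pi.add_apply] at hsub
    rw [hsub, integral_add i3 i1, integral_const_mul, e1, e2, e3, huv, hvv]
    ring
  have hint : Integrable (fun x => (u (shift x) - u x) ^ 2) Q := by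
    simp_rw [hsq]
    exact (i3.add i1).sub (i2.const_mul 2)
  have := (integral_eq_zero_iff_of_nonneg (fun x => sq_nonneg _) hint).1 hzero
  filter_upwards [this] with x hx
  have hx' : u (shift x) = u x := sub_eq_zero.1 (pow_eq_zero_iff two_ne_zero |>.1 hx)
  exact (ENNReal.toReal_eq_toReal_iff' (measure_ne_top _ _) (measure_ne_top _ _)).1 hx'

lemma InjInvariant.ae_directing_shift_iterate (hQ : InjInvariant Q) (m : ℕ) :
    ∀ᵐ x ∂Q, directing Q (shift^[m] x) = directing Q x := by
  have h1 : ∀ᵐ x ∂Q, directing Q (shift x) = directing Q x :=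
    ae_eq_of_forall_ae_measure_eq fun _ hs => hQ.ae_directing_shift_apply hs
  induction m with
  | zero => simp
  | succ m ih =>
    filter_upwards [h1, hQ.measurePreserving_shift.quasiMeasurePreserving.ae ih] with x hx hx'
    rw [Function.iterate_succ_apply, hx', hx]

/-- Conditional independence of the first `m` coordinates given the later ones, with common
conditional law the directing measure. -/
lemma InjInvariant.lintegral_prod_indicator_mul (hQ : InjInvariant Q) (m : ℕ) (B : ℕ → Set T)
    (hB : ∀ i, MeasurableSet (B i)) {f : (ℕ → T) → ENNReal} (hf : Measurable f) :
    ∫⁻ x, (∏ i ∈ Finset.range m, (B i).indicator 1 (x i)) * f (shift^[m] x) ∂Q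
      = ∫⁻ x, (∏ i ∈ Finset.range m, (directing Q x : Measure T) (B i)) * f (shift^[m] x) ∂Q := by
  induction m generalizing B f with
  | zero => simp
  | succ m ih =>
    have hg := fun i => measurable_directing_apply Q (hB i)
    have hI : ∀ i j : ℕ, Measurable fun x : ℕ → T => (B i).indicator (1 : T → ENNReal) (x j) :=
      fun i j => (measurable_one.indicator (hB i)).comp (measurable_pi_apply j)
    have hfm : Measurable fun x => f (shift^[m] x) := hf.comp (measurable_shift_iterate m)
    let F : (ℕ → T) → ENNReal := fun y =>
      (∏ i ∈ Finset.range m, (B (i + 1)).indicator 1 (y i)) * f (shift^[m] y)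
    have hF : Measurable F :=
      (Finset.measurable_prod _ fun i _ => hI (i + 1) i).mul hfm
    have hinv := hQ.ae_directing_shift_iterate 1
    have hinvm := hQ.ae_directing_shift_iterate m
    calc ∫⁻ x, (∏ i ∈ Finset.range (m + 1), (B i).indicator 1 (x i)) * f (shift^[m + 1] x) ∂Q
        = ∫⁻ x, (B 0).indicator 1 (x 0) * F (shift x) ∂Q := by
          refine lintegral_congr fun x => ?_
          rw [Finset.prod_range_succ', Function.iterate_succ_apply]
          simp only [F, shift]
          ring
      _ = ∫⁻ x, (directing Q x : Measure T) (B 0) * F (shift x) ∂Q :=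
          lintegral_indicator_mul_shift Q (hB 0) hF
      _ = ∫⁻ x, (directing Q (shift x) : Measure T) (B 0) * F (shift x) ∂Q := by
          refine lintegral_congr_ae ?_
          filter_upwards [hinv] with x hx
          rw [← hx, Function.iterate_one]
      _ = ∫⁻ y, (directing Q y : Measure T) (B 0) * F y ∂Q :=
          hQ.measurePreserving_shift.lintegral_comp ((hg 0).mul hF)
      _ = ∫⁻ y, (∏ i ∈ Finset.range m, (B (i + 1)).indicator 1 (y i)) *
            ((directing Q (shift^[m] y) : Measure T) (B 0) * f (shift^[m] y)) ∂Q := by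
          refine lintegral_congr_ae ?_
          filter_upwards [hinvm] with y hy
          rw [hy]
          simp only [F]
          ring
      _ = ∫⁻ y, (∏ i ∈ Finset.range m, (directing Q y : Measure T) (B (i + 1))) *
            ((directing Q (shift^[m] y) : Measure T) (B 0) * f (shift^[m] y)) ∂Q :=
          ih (fun i => B (i + 1)) (fun i => hB (i + 1)) ((hg 0).mul hf)
      _ = ∫⁻ y, (∏ i ∈ Finset.range (m + 1), (directing Q y : Measure T) (B i)) *
            f (shift^[m] y) ∂Q := by
          refine lintegral_congr_ae ?_
          filter_upwards [hinvm] with y hy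
          rw [hy, Finset.prod_range_succ']
          ring
      _ = ∫⁻ x, (∏ i ∈ Finset.range (m + 1), (directing Q (shift x) : Measure T) (B i)) *
            f (shift^[m] (shift x)) ∂Q :=
          (hQ.measurePreserving_shift.lintegral_comp
            ((Finset.measurable_prod _ fun i _ => hg i).mul hfm)).symm
      _ = _ := by
          refine lintegral_congr_ae ?_
          filter_upwards [hinv] with x hx
          rw [Function.iterate_one] at hx
          rw [hx, Function.iterate_succ_apply]

/-- De Finetti's theorem on sequence space: given its directing measure `ν`, the coordinate
sequence has law `ν^∞`. -/
theorem InjInvariant.hasCondDistrib_directing (hQ : InjInvariant Q) :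
    HasCondDistrib id (directing Q) (kernelOf infProd measurable_infProd) Q := by
  have hd := measurable_directing Q
  rw [hasCondDistrib_kernelOf_iff measurable_id hd]
  intro C A hC hA
  have hinf : Measurable fun x => (infProd (directing Q x) : Measure (ℕ → T)) :=
    measurable_subtype_coe.comp (measurable_infProd.comp hd)
  let Q' := Q.restrict (directing Q ⁻¹' C)
  suffices h : Q' = Q'.bind fun x => (infProd (directing Q x) : Measure (ℕ → T)) by
    have h' := congrArg (fun ν => ν A) h
    rw [Measure.bind_apply hA hinf.aemeasurable, Measure.restrict_apply hA] at h'
    rw [Set.preimage_id, Set.inter_comm]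
    exact h'
  refine ext_of_generate_finite _ generateFrom_squareCylinders.symm
    (isPiSystem_squareCylinders (fun _ => MeasurableSpace.isPiSystem_measurableSet)
      (fun _ => MeasurableSet.univ)) ?_ ?_
  · rintro _ ⟨s, t, ht, rfl⟩
    have ht' : ∀ i, MeasurableSet (t i) := fun i => ht i (Set.mem_univ i)
    -- Pad the cylinder with trivial constraints so that it constrains an initial segment.
    let B : ℕ → Set T := fun i => if i ∈ s then t i else Set.univ
    have hB : ∀ i, MeasurableSet (B i) := fun i => by
      simp only [B]
      split_ifs
      exacts [ht' i, .univ]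
    let m := s.sup id + 1
    have hsm : ∀ i ∈ s, i < m := fun i hi => Nat.lt_succ_of_le (Finset.le_sup (f := id) hi)
    have hset : (s : Set ℕ).pi t = (Finset.range m : Set ℕ).pi B := by
      ext x
      simp only [Set.mem_pi, Finset.mem_coe, Finset.mem_range, B]
      constructor
      · intro h i _
        split_ifs with hi
        exacts [h i hi, Set.mem_univ _]
      · intro h i hi
        simpa [hi] using h i (hsm i hi)
    have hmB : MeasurableSet ((Finset.range m : Set ℕ).pi B) :=
      MeasurableSet.pi (Finset.countable_toSet _) fun i _ => hB i
    have hCm := hd hC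
    rw [hset, Measure.bind_apply hmB hinf.aemeasurable, Measure.restrict_apply hmB]
    have hinvm := hQ.ae_directing_shift_iterate m
    have hmain := hQ.lintegral_prod_indicator_mul m B hB
      (f := (directing Q ⁻¹' C).indicator 1) (measurable_one.indicator hCm)
    have hind : ∀ᵐ x ∂Q, (directing Q ⁻¹' C).indicator (1 : (ℕ → T) → ENNReal) (shift^[m] x)
        = (directing Q ⁻¹' C).indicator 1 x := by
      filter_upwards [hinvm] with x hx
      classical
      rw [Set.indicator_apply, Set.indicator_apply, Set.mem_preimage, Set.mem_preimage, hx]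
      rfl
    calc Q ((Finset.range m : Set ℕ).pi B ∩ directing Q ⁻¹' C)
        = ∫⁻ x, (∏ i ∈ Finset.range m, (B i).indicator 1 (x i)) *
            (directing Q ⁻¹' C).indicator 1 (shift^[m] x) ∂Q := by
          rw [← lintegral_indicator_one (hmB.inter hCm)]
          refine lintegral_congr_ae ?_
          filter_upwards [hind] with x hx
          rw [hx, Set.inter_indicator_one, Pi.mul_apply]
          congr 1
          by_cases hxB : x ∈ (Finset.range m : Set ℕ).pi B
          · rw [Set.indicator_of_mem hxB, Finset.prod_eq_one]
            · rfl
            · intro i hi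
              rw [Set.indicator_of_mem (hxB i hi)]
              rfl
          · rw [Set.indicator_of_notMem hxB]
            simp only [Set.mem_pi, not_forall] at hxB
            obtain ⟨i, hi, hxi⟩ := hxB
            exact (Finset.prod_eq_zero hi (Set.indicator_of_notMem hxi _)).symm
      _ = _ := hmain
      _ = ∫⁻ x in directing Q ⁻¹' C,
            (infProd (directing Q x) : Measure (ℕ → T)) ((Finset.range m : Set ℕ).pi B) ∂Q := by
          rw [← lintegral_indicator hCm]
          refine lintegral_congr_ae ?_
          filter_upwards [hind] with x hx
          rw [hx]
          have : (infProd (directing Q x) : Measure (ℕ → T)) ((Finset.range m : Set ℕ).pi B)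
              = ∏ i ∈ Finset.range m, (directing Q x : Measure T) (B i) :=
            Measure.infinitePi_pi _ fun i _ => hB i
          by_cases hxC : x ∈ directing Q ⁻¹' C
          · rw [Set.indicator_of_mem hxC, Set.indicator_of_mem hxC, this, Pi.one_apply, mul_one]
          · rw [Set.indicator_of_notMem hxC, Set.indicator_of_notMem hxC, mul_zero]
  · rw [Measure.bind_apply .univ hinf.aemeasurable]
    simp

end DeFinetti

/-! ### Law of large numbers and almost sure uniqueness -/

section Uniqueness

variable {Ω T : Type*} [MeasurableSpace Ω] [MeasurableSpace T] {P : Measure Ω}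

/-- The fraction of the first `n` terms of a sequence that lie in `B`. -/
noncomputable def empiricalFreq (B : Set T) (n : ℕ) (x : ℕ → T) : ℝ :=
  (∑ i ∈ Finset.range n, B.indicator 1 (x i)) / n

lemma measurable_empiricalFreq {B : Set T} (hB : MeasurableSet B) (n : ℕ) :
    Measurable (empiricalFreq B n) :=
  (Finset.measurable_sum _ fun i _ =>
    (measurable_one.indicator hB).comp (measurable_pi_apply i)).div_const _

lemma tendsto_empiricalFreq_infProd (ν : ProbabilityMeasure T) {B : Set T}
    (hB : MeasurableSet B) :
    ∀ᵐ x ∂(infProd ν : Measure (ℕ → T)),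
      Filter.Tendsto (fun n => empiricalFreq B n x) Filter.atTop (nhds ((ν : Measure T).real B)) := by
  have hI : Measurable (B.indicator (1 : T → ℝ)) := measurable_one.indicator hB
  have heval : ∀ i : ℕ, MeasurePreserving (Function.eval i)
      (Measure.infinitePi fun _ : ℕ => (ν : Measure T)) (ν : Measure T) :=
    fun i => measurePreserving_eval_infinitePi _ i
  have hint : Integrable (B.indicator (1 : T → ℝ)) (ν : Measure T) :=
    (integrable_const (1 : ℝ)).indicator hB
  have h := strong_law_ae_real (μ := Measure.infinitePi fun _ : ℕ => (ν : Measure T))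
    (fun i x => B.indicator (1 : T → ℝ) (x i))
    ((heval 0).integrable_comp_of_integrable hint)
    (fun i j hij => (iIndepFun_infinitePi (P := fun _ : ℕ => (ν : Measure T))
      (X := fun _ => B.indicator (1 : T → ℝ)) fun _ => hI).indepFun hij)
    (fun i => IdentDistrib.comp ⟨(measurable_pi_apply i).aemeasurable,
      (measurable_pi_apply 0).aemeasurable, (heval i).map_eq.trans (heval 0).map_eq.symm⟩ hI)
  have hmean : ∫ x, B.indicator (1 : T → ℝ) (x 0) ∂(Measure.infinitePi fun _ : ℕ => (ν : Measure T))
      = (ν : Measure T).real B := by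
    have := integral_map (μ := Measure.infinitePi fun _ : ℕ => (ν : Measure T))
      (heval 0).measurable.aemeasurable (hI.aestronglyMeasurable (μ := Measure.map _ _))
    rw [(heval 0).map_eq, integral_indicator_one hB] at this
    exact this.symm
  rw [hmean] at h
  exact h

/-- A conditionally i.i.d. sequence obeys the law of large numbers with the random limit `ν(B)`. -/
lemma tendsto_empiricalFreq_of_hasCondDistrib {X : Ω → ℕ → T} {ν : Ω → ProbabilityMeasure T}
    (h : HasCondDistrib X ν (kernelOf infProd measurable_infProd) P) {B : Set T}
    (hB : MeasurableSet B) :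
    ∀ᵐ ω ∂P, Filter.Tendsto (fun n => empiricalFreq B n (X ω)) Filter.atTop
      (nhds ((ν ω : Measure T).real B)) := by
  have hset : MeasurableSet {p : ProbabilityMeasure T × (ℕ → T) |
      Filter.Tendsto (fun n => empiricalFreq B n p.2) Filter.atTop
        (nhds ((p.1 : Measure T).real B))} :=
    measurableSet_tendsto_fun (fun n => (measurable_empiricalFreq hB n).comp measurable_snd)
      (((Measure.measurable_coe hB).comp
        (measurable_subtype_coe.comp measurable_fst)).ennreal_toReal)
  have hae := Measure.ae_compProd_of_ae_ae (μ := P.map ν)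
    (κ := kernelOf (infProd (T := T)) measurable_infProd) hset
    (.of_forall fun m => tendsto_empiricalFreq_infProd m hB)
  rw [← h.map_eq] at hae
  exact ae_of_ae_map h.aemeasurable hae

/-- The directing measure of a conditionally i.i.d. sequence is almost surely unique: both
candidates give each set `B` the limiting frequency of visits to `B`. -/
lemma ae_eq_of_hasCondDistrib_infProd [MeasurableSpace.CountablyGenerated T] {X : Ω → ℕ → T}
    {ν ν' : Ω → ProbabilityMeasure T}
    (h : HasCondDistrib X ν (kernelOf infProd measurable_infProd) P)
    (h' : HasCondDistrib X ν' (kernelOf infProd measurable_infProd) P) :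
    ∀ᵐ ω ∂P, ν' ω = ν ω := by
  refine ae_eq_of_forall_ae_measure_eq fun B hB => ?_
  filter_upwards [tendsto_empiricalFreq_of_hasCondDistrib h hB,
    tendsto_empiricalFreq_of_hasCondDistrib h' hB] with ω h1 h2
  exact (measureReal_eq_measureReal_iff).1 (tendsto_nhds_unique h2 h1)

end Uniqueness

/-! ### Exchangeable sequences -/

section Exchangeable

variable {Ω T : Type*} [MeasurableSpace Ω] [MeasurableSpace T] {P : Measure Ω}

lemma Exchangeable.comp {U : Type*} [MeasurableSpace U] {X : ℕ → Ω → T} (h : Exchangeable P X)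
    {g : T → U} (hg : Measurable g) : Exchangeable P fun i ω => g (X i ω) :=
  fun m k hk => (h m k hk).comp (u := fun (y : Fin m → T) j => g (y j))
    (measurable_pi_lambda _ fun j => hg.comp (measurable_pi_apply j))

lemma Exchangeable.identDistrib {X : ℕ → Ω → T} (h : Exchangeable P X) (i : ℕ) :
    IdentDistrib (X i) (X 0) P P :=
  (h 1 (fun _ => i) (Function.injective_of_subsingleton _)).comp
    (u := fun y : Fin 1 → T => y 0) (measurable_pi_apply 0)

/-- Exchangeability, a condition on finite-dimensional distributions, gives invariance of the
law of the whole sequence under every injective reindexing. -/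
lemma Exchangeable.injInvariant [IsFiniteMeasure P] {X : ℕ → Ω → T} (h : Exchangeable P X)
    (hX : ∀ i, Measurable (X i)) : InjInvariant (P.map fun ω i => X i ω) := by
  intro k hk
  have hXm : Measurable fun ω i => X i ω := measurable_pi_lambda _ hX
  have hkm : Measurable fun (x : ℕ → T) i => x (k i) :=
    measurable_pi_lambda _ fun i => measurable_pi_apply (k i)
  have hXk : Measurable fun ω i => X (k i) ω := measurable_pi_lambda _ fun i => hX (k i)
  rw [Measure.map_map hkm hXm]
  refine (map_eq_iff_forall_finset_map_restrict_eq (X := fun i => X (k i)) hXk.aemeasurable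
    hXm.aemeasurable).2 fun I => ?_
  let m := I.sup id + 1
  have hIm : ∀ i ∈ I, i < m := fun i hi => Nat.lt_succ_of_le (Finset.le_sup (f := id) hi)
  exact ((h m (fun j => k j) (hk.comp Fin.val_injective)).comp
    (u := fun (y : Fin m → T) (i : I) => y ⟨i, hIm i i.2⟩)
    (measurable_pi_lambda _ fun i => measurable_pi_apply _)).map_eq

/-- De Finetti's theorem for a random sequence. The map `directing Q` depends only on the law `Q`,
so that sequences with the same law can share it. -/
theorem hasCondDistrib_directing_comp [StandardBorelSpace T] [Nonempty T]
    {Q : Measure (ℕ → T)} [IsProbabilityMeasure Q] (hQ : InjInvariant Q) {X : Ω → ℕ → T}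
    (hX : Measurable X) (hXQ : P.map X = Q) :
    HasCondDistrib X (fun ω => directing Q (X ω)) (kernelOf infProd measurable_infProd) P := by
  have hd := measurable_directing Q
  refine ⟨((hd.comp hX).prodMk hX).aemeasurable, ?_⟩
  have h := hQ.hasCondDistrib_directing.map_eq
  have h1 := Measure.map_map (μ := P) (hd.prodMk measurable_id) hX
  have h2 := Measure.map_map (μ := P) hd hX
  rw [hXQ] at h1 h2
  rw [h1, h2] at h
  exact h

end Exchangeable

/-! ### Row exchangeable arrays -/

theorem theorem3p2 {Ω S : Type*} [MeasurableSpace Ω] (P : Measure Ω) [IsProbabilityMeasure P]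
    [MetricSpace S] [CompleteSpace S] [TopologicalSpace.SeparableSpace S]
    [MeasurableSpace S] [BorelSpace S]
    (ξ : ℕ → ℕ → Ω → S) (hξ : ∀ i j, Measurable (ξ i j)) (hex : RowExchangeable P ξ) :
    ∃ (ϖ : Ω → ProbabilityMeasure (ProbabilityMeasure S)) (μ : ℕ → Ω → ProbabilityMeasure S),
      Measurable ϖ ∧ (∀ i, Measurable (μ i)) ∧
      CondLaw P (fun ω i => μ i ω) ϖ (fun ω => infProd (ϖ ω)) ∧
      (∀ i, CondLaw P (fun ω j => ξ i j ω) (μ i) (fun ω => infProd (μ i ω))) ∧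
      ∀ (ϖ' : Ω → ProbabilityMeasure (ProbabilityMeasure S))
        (μ' : ℕ → Ω → ProbabilityMeasure S),
        Measurable ϖ' → (∀ i, Measurable (μ' i)) →
        CondLaw P (fun ω i => μ' i ω) ϖ' (fun ω => infProd (ϖ' ω)) →
        (∀ i, CondLaw P (fun ω j => ξ i j ω) (μ' i) (fun ω => infProd (μ' i ω))) →
        (∀ᵐ ω ∂P, ϖ' ω = ϖ ω) ∧ (∀ᵐ ω ∂P, ∀ i, μ' i ω = μ i ω) := by
  obtain ⟨ω₀⟩ : Nonempty Ω := nonempty_of_isProbabilityMeasure P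
  have : Nonempty S := ⟨ξ 0 0 ω₀⟩
  have hrow : ∀ i, Measurable fun ω j => ξ i j ω := fun i => measurable_pi_lambda _ (hξ i)
  -- All rows share the law `Q` of the first one, hence a common directing map.
  let Q : Measure (ℕ → S) := P.map fun ω j => ξ 0 j ω
  have : IsProbabilityMeasure Q := Measure.isProbabilityMeasure_map (hrow 0).aemeasurable
  have hQ : InjInvariant Q := (hex.row 0).injInvariant (hξ 0)
  let μ : ℕ → Ω → ProbabilityMeasure S := fun i ω => directing Q fun j => ξ i j ω
  have hμ : ∀ i, Measurable (μ i) := fun i => (measurable_directing Q).comp (hrow i)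
  have hμξ : ∀ i, HasCondDistrib (fun ω j => ξ i j ω) (μ i)
      (kernelOf infProd measurable_infProd) P :=
    fun i => hasCondDistrib_directing_comp hQ (hrow i) (hex.rows.identDistrib i).map_eq
  have hμseq : Measurable fun ω i => μ i ω := measurable_pi_lambda _ hμ
  have hμex : Exchangeable P μ := hex.rows.comp (measurable_directing Q)
  have : Nonempty (ProbabilityMeasure S) := ⟨μ 0 ω₀⟩
  let R : Measure (ℕ → ProbabilityMeasure S) := P.map fun ω i => μ i ω
  have : IsProbabilityMeasure R := Measure.isProbabilityMeasure_map hμseq.aemeasurable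
  let ϖ : Ω → ProbabilityMeasure (ProbabilityMeasure S) := fun ω => directing R fun i => μ i ω
  have hϖ : Measurable ϖ := (measurable_directing R).comp hμseq
  have hϖμ : HasCondDistrib (fun ω i => μ i ω) ϖ (kernelOf infProd measurable_infProd) P :=
    hasCondDistrib_directing_comp (hμex.injInvariant hμ) hμseq rfl
  refine ⟨ϖ, μ, hϖ, hμ, (condLaw_iff_hasCondDistrib hμseq hϖ measurable_infProd).2 hϖμ,
    fun i => (condLaw_iff_hasCondDistrib (hrow i) (hμ i) measurable_infProd).2 (hμξ i), ?_⟩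
  intro ϖ' μ' hϖ' hμ' hϖμ' hμξ'
  have hμseq' : Measurable fun ω i => μ' i ω := measurable_pi_lambda _ hμ'
  have hμμ' : ∀ᵐ ω ∂P, ∀ i, μ' i ω = μ i ω := ae_all_iff.2 fun i =>
    ae_eq_of_hasCondDistrib_infProd (hμξ i)
      ((condLaw_iff_hasCondDistrib (hrow i) (hμ' i) measurable_infProd).1 (hμξ' i))
  refine ⟨?_, hμμ'⟩
  have h' := (condLaw_iff_hasCondDistrib hμseq' hϖ' measurable_infProd).1 hϖμ'
  -- Replacing `μ'` by its version `μ` does not change its joint law with `ϖ'`.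
  refine ae_eq_of_hasCondDistrib_infProd hϖμ ⟨(hϖ'.prodMk hμseq).aemeasurable, ?_⟩
  rw [← h'.map_eq]
  refine Measure.map_congr ?_
  filter_upwards [hμμ'] with ω hω
  simp [hω]
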